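/- Let $k$ be a field. For a quiver $Q$ with vertex set $Q_0$ let $kQ$ be its path algebra (basis: all paths, including the stationary paths $e_x$, $x\in Q_0$), let $kQ(x,y)$ be the span of the paths from $x$ to $y$, and let $F$ be the ideal generated by the arrows. A *bound quiver* $(Q,I)$ is a quiver $Q$ with a two-sided ideal $I$ of $kQ$ such that $F^m\subseteq I\subseteq F^2$ for some $m\ge 2$; put $I(x,y)=I\cap kQ(x,y)$. *The classifying space.* A *minimal relation* is an element $\sum_{i=1}^m\lambda_iw_i\in I(x,y)$, with $m\ge 2$, $\lambda_i\in k\setminus\{0\}$ and distinct paths $w_i$ from $x$ to $y$, such that $\sum_{i\in J}\lambda_iw_i\notin I(x,y)$ for every nonempty proper subset $J\subset\{1,\dots,m\}$. *Natural homotopy* is the equivalence relation on paths generated by $uvw\sim uv'w$, where $u,w$ are paths and $v,v'$ are paths appearing in the same minimal relation; $\widetilde\sigma$ denotes the class of $\sigma$. Let $\mathcal C_0=Q_0$ and, for $n\ge 1$, let $\mathcal C_n$ be the set of $n$-tuples $(\widetilde\sigma_1,\dots,\widetilde\sigma_n)$ for which representatives $\sigma_i$ can be chosen that are nonstationary and composable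 with $\sigma_1\cdots\sigma_n\notin I$. The faces of such a tuple are $\partial_0=(\widetilde\sigma_2,\dots,\widetilde\sigma_n)$, $\partial_i=(\widetilde\sigma_1,\dots,\widetilde{\sigma_i\sigma_{i+1}},\dots,\widetilde\sigma_n)$ for $0<i<n$, and $\partial_n=(\widetilde\sigma_1,\dots,\widetilde\sigma_{n-1})$; for $n=1$ and $\sigma$ from $x$ to $y$, $\partial_0\widetilde\sigma=y$ and $\partial_1\widetilde\sigma=x$. The *classifying space* $\mathcal B(Q,I)$ is the CW-complex obtained from $\coprod_n\coprod_{\boldsymbol\sigma\in\mathcal C_n}\Delta^n_{\boldsymbol\sigma}$ by identifying, for all $\boldsymbol\sigma$ and $j$, the face $\{t_j=0\}$ of $\Delta^n_{\boldsymbol\sigma}$ with $\Delta^{n-1}_{\partial_j\boldsymbol\sigma}$, with the quotient topology. *Coverings.* A morphism of bound quivers $p:(\hat Q,\hat I)\to(Q,I)$ is a morphism of quivers whose $k$-linear extension maps $\hat I$ into $I$. It is a *covering morphism* if (1) every vertex of $Q$ has a nonempty fibre; (2) for every vertex $\hat x$ of $\hat Q$, $p$ induces bijections from the arrows leaving (entering)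 $\hat x$ to the arrows leaving (entering) $p(\hat x)$; (3) for all $x,y\in Q_0$, $\rho\in I(x,y)$ and $\hat x\in p^{-1}(x)$ there are $\hat y\in p^{-1}(y)$ and $\hat\rho\in\hat I(\hat x,\hat y)$ with $p(\hat\rho)=\rho$. It is then a *Galois covering given by a group $G$* acting by automorphisms of $(\hat Q,\hat I)$ if moreover (4) $pg=p$ for all $g\in G$; (5) $G$ acts transitively on the fibre $p^{-1}(x)$ of every vertex $x$ and on the fibre $p^{-1}(\alpha)$ of every arrow $\alpha$ of $Q$; (6) no $g\ne 1$ in $G$ fixes a vertex of $\hat Q$. A covering morphism $p$ induces a well-defined continuous map $\mathcal Bp:\mathcal B(\hat Q,\hat I)\to\mathcal B(Q,I)$, which maps the simplex of $(\widetilde\sigma_1,\dots,\widetilde\sigma_n)$ identically onto the simplex of $(\widetilde{p(\sigma_1)},\dots,\widetilde{p(\sigma_n)})$. **Theorem 4.5.** Let $(Q,I)$ and $(\hat Q,\hat I)$ be bound quivers with $Q$ finite and $\hat Q$ nonempty and connected (not necessarily finite), and let $p:(\hat Q,\hat I)\to(Q,I)$ be a Galois covering given by a group $G$. Then $\mathcal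 Bp:\mathcal B(\hat Q,\hat I)\to\mathcal B(Q,I)$ is a regular covering: $\mathcal B(\hat Q,\hat I)$ is path connected, $\mathcal Bp$ is a surjective covering map, and for every base point $b$ the image of $(\mathcal Bp)_*:\pi_1(\mathcal B(\hat Q,\hat I),b)\to\pi_1(\mathcal B(Q,I),\mathcal Bp(b))$ is a normal subgroup. Moreover, the group of covering automorphisms of $\mathcal Bp$, that is, of the homeomorphisms $\varphi$ of $\mathcal B(\hat Q,\hat I)$ with $\mathcal Bp\circ\varphi=\mathcal Bp$, is isomorphic to $G$. -/

import Mathlib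

universe u u' v v' w

/-! ### Paths, the path algebra of a quiver and its two-sided ideals -/

section PathAlgebra

/-- The set of all paths of `Q`, including one stationary path `e_x` for each vertex `x`.
An element is a triple (source, target, path). -/
abbrev AnyPath (Q : Type u) [Quiver.{v} Q] : Type (max u v) :=
  Σ x : Q, Σ y : Q, Quiver.Path x y

/-- The path `p`, with its source and target forgotten from the type. -/
abbrev AnyPath.mk {Q : Type u} [Quiver.{v} Q] {x y : Q} (p : Quiver.Path x y) : AnyPath Q :=
  ⟨x, y, p⟩

/-- The underlying vector space of the path algebra `kQ`: it has the set of all paths of `Q`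
as a basis. -/
abbrev PathAlgebra (k : Type w) [Field k] (Q : Type u) [Quiver.{v} Q] : Type (max u v w) :=
  AnyPath Q →₀ k

namespace PathAlgebra

variable (k : Type w) [Field k] {Q : Type u} [Quiver.{v} Q]

/-- The basis element of `kQ` given by a path. -/
noncomputable def ofPath (s : AnyPath Q) : PathAlgebra k Q :=
  Finsupp.single s 1

open Classical in
/-- The product of two paths in `kQ`: their concatenation (first `s`, then `t`) if the target of
`s` is the source of `t`, and `0` otherwise. -/
noncomputable def mulPath (s t : AnyPath Q) : PathAlgebra k Q :=
  if h : t.1 = s.2.1 then ofPath k (AnyPath.mk (s.2.2.comp (t.2.2.cast h rfl))) else 0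

/-- The multiplication of the path algebra `kQ`: the bilinear extension of the product of
paths. -/
noncomputable def mul : PathAlgebra k Q →ₗ[k] PathAlgebra k Q →ₗ[k] PathAlgebra k Q :=
  Finsupp.linearCombination k fun s => Finsupp.linearCombination k fun t => mulPath k s t

theorem mul_ofPath_ofPath {x y z : Q} (p : Quiver.Path x y) (q : Quiver.Path y z) :
    mul k (ofPath k (AnyPath.mk p)) (ofPath k (AnyPath.mk q)) =
      ofPath k (AnyPath.mk (p.comp q)) := by
  simp [mul, ofPath, mulPath]

/-- The subspace `kQ(x,y)` of `kQ` spanned by the paths from `x` to `y`. -/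
def homSpace (x y : Q) : Submodule k (PathAlgebra k Q) :=
  Finsupp.supported k k {s : AnyPath Q | s.1 = x ∧ s.2.1 = y}

variable (Q) in
/-- The power `F ^ m` of the two-sided ideal `F` of `kQ` generated by the arrows, that is, the
subspace spanned by the paths of length at least `m`. -/
def arrowIdealPow (m : ℕ) : Submodule k (PathAlgebra k Q) :=
  Finsupp.supported k k {s : AnyPath Q | m ≤ s.2.2.length}

end PathAlgebra

/-- A two-sided ideal of the path algebra `kQ`. -/
structure PathIdeal (k : Type w) [Field k] (Q : Type u) [Quiver.{v} Q] extends
    Submodule k (PathAlgebra k Q) where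
  mul_mem_left : ∀ a b : PathAlgebra k Q, b ∈ carrier → PathAlgebra.mul k a b ∈ carrier
  mul_mem_right : ∀ a b : PathAlgebra k Q, a ∈ carrier → PathAlgebra.mul k a b ∈ carrier

instance (k : Type w) [Field k] (Q : Type u) [Quiver.{v} Q] :
    Membership (PathAlgebra k Q) (PathIdeal k Q) :=
  ⟨fun I a => a ∈ I.toSubmodule⟩

/-- The ideal `I` is admissible: `F ^ m ⊆ I ⊆ F ^ 2` for some `m ≥ 2`. A bound quiver is a
quiver `Q` with an admissible ideal `I` of `kQ`. -/
def PathIdeal.IsAdmissible {k : Type w} [Field k] {Q : Type u} [Quiver.{v} Q]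
    (I : PathIdeal k Q) : Prop :=
  ∃ m : ℕ, 2 ≤ m ∧ PathAlgebra.arrowIdealPow k Q m ≤ I.toSubmodule ∧
    I.toSubmodule ≤ PathAlgebra.arrowIdealPow k Q 2

/-- A quiver is connected if it is nonempty and any two of its vertices are joined by a walk, that
is, by a path in the quiver obtained by adding a formal inverse of every arrow. -/
def IsConnectedQuiver (Q : Type u) [Quiver.{v} Q] : Prop :=
  Nonempty Q ∧ ∀ x y : Q, Nonempty (@Quiver.Path (Quiver.Symmetrify Q) _ x y)

end PathAlgebra

/-! ### Minimal relations and natural homotopy -/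

section NaturalHomotopy

variable {k : Type w} [Field k] {Q : Type u} [Quiver.{v} Q] (I : PathIdeal k Q)

open Classical in
/-- `ρ = ∑ λᵢ wᵢ ∈ I(x,y)` (with `λᵢ ≠ 0` and `wᵢ` distinct paths from `x` to `y`, so that the
`wᵢ` form the support of `ρ`) is a minimal relation: it has at least two terms, and no partial
sum over a nonempty proper subset of its terms lies in `I`. -/
def IsMinimalRelation (x y : Q) (ρ : PathAlgebra k Q) : Prop :=
  ρ ∈ I ∧ ρ ∈ PathAlgebra.homSpace k x y ∧ 2 ≤ ρ.support.card ∧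
    ∀ J : Finset (AnyPath Q), J ⊂ ρ.support → J.Nonempty → ρ.filter (· ∈ J) ∉ I

/-- Two parallel paths `p = u v w` and `p' = u v' w`, where `v` and `v'` appear in the same minimal
relation. -/
inductive NaturalHomotopyStep : AnyPath Q → AnyPath Q → Prop
  | intro {a x y b : Q} (u : Quiver.Path a x) (v v' : Quiver.Path x y) (w : Quiver.Path y b)
      (ρ : PathAlgebra k Q) (hρ : IsMinimalRelation I x y ρ)
      (hv : AnyPath.mk v ∈ ρ.support) (hv' : AnyPath.mk v' ∈ ρ.support) :
      NaturalHomotopyStep (AnyPath.mk (u.comp (v.comp w))) (AnyPath.mk (u.comp (v'.comp w)))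

/-- Natural homotopy of paths: the equivalence relation generated by the elementary steps. -/
def NaturallyHomotopic : AnyPath Q → AnyPath Q → Prop :=
  Relation.EqvGen (NaturalHomotopyStep I)

end NaturalHomotopy

/-! ### The cells of the classifying space -/

section Cells

/-- A sequence `σ₁, …, σₙ` of composable paths
`vertex 0 ⟶ vertex 1 ⟶ ⋯ ⟶ vertex n` of `Q`, recorded together with all the compositions of
consecutive terms: `path i j = σ_{i+1} ⋯ σ_j` for `i ≤ j`; in particular `σᵢ = path (i-1) i`. -/
structure PathChain (Q : Type u) [Quiver.{v} Q] (n : ℕ) where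
  vertex : Fin (n + 1) → Q
  path : ∀ i j : Fin (n + 1), i ≤ j → Quiver.Path (vertex i) (vertex j)
  path_self : ∀ i, path i i le_rfl = Quiver.Path.nil
  path_comp : ∀ (i j l : Fin (n + 1)) (hij : i ≤ j) (hjl : j ≤ l),
    (path i j hij).comp (path j l hjl) = path i l (hij.trans hjl)

/-- Deleting the vertex number `j`: the first or last path is dropped if `j = 0` or `j = n + 1`,
and `σ_j`, `σ_{j+1}` are replaced by `σ_j σ_{j+1}` if `0 < j < n + 1`. -/
def PathChain.face {Q : Type u} [Quiver.{v} Q] {n : ℕ} (c : PathChain Q (n + 1))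
    (j : Fin (n + 2)) : PathChain Q n where
  vertex i := c.vertex (j.succAbove i)
  path i l h := c.path (j.succAbove i) (j.succAbove l) (j.strictMono_succAbove.monotone h)
  path_self _ := c.path_self _
  path_comp _ _ _ _ _ := c.path_comp _ _ _ _ _

variable {k : Type w} [Field k] {Q : Type u} [Quiver.{v} Q] (I : PathIdeal k Q)

/-- None of the paths `σᵢ` is stationary, and `σ₁ ⋯ σₙ ∉ I`. -/
structure PathChain.IsCellChain {n : ℕ} (c : PathChain Q n) : Prop where
  length_pos : ∀ (i j : Fin (n + 1)) (h : i < j), 0 < (c.path i j h.le).length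
  total_notMem : PathAlgebra.ofPath k (AnyPath.mk (c.path 0 (Fin.last n) (Fin.zero_le _))) ∉ I

theorem PathIdeal.ofPath_mid_mem {a x y b : Q} (u : Quiver.Path a x) (m : Quiver.Path x y)
    (w : Quiver.Path y b) (h : PathAlgebra.ofPath k (AnyPath.mk m) ∈ I) :
    PathAlgebra.ofPath k (AnyPath.mk (u.comp (m.comp w))) ∈ I := by
  rw [← PathAlgebra.mul_ofPath_ofPath, ← PathAlgebra.mul_ofPath_ofPath]
  exact I.mul_mem_left _ _ (I.mul_mem_right _ _ h)

theorem PathChain.IsCellChain.face {n : ℕ} {c : PathChain Q (n + 1)} (hc : c.IsCellChain I)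
    (j : Fin (n + 2)) : (c.face j).IsCellChain I where
  length_pos i l h := hc.length_pos _ _ (j.strictMono_succAbove h)
  total_notMem h := by
    apply hc.total_notMem
    have := I.ofPath_mid_mem (c.path 0 (j.succAbove 0) (Fin.zero_le _)) _
      (c.path (j.succAbove (Fin.last n)) (Fin.last (n + 1)) (Fin.le_last _)) h
    simp only [PathChain.face] at this
    rwa [c.path_comp, c.path_comp] at this

/-- Two sequences of composable paths are identified when their terms are naturally
homotopic. -/
def PathChain.Homotopic {n : ℕ} (c c' : PathChain Q n) : Prop :=
  ∀ (i j : Fin (n + 1)) (h : i ≤ j),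
    NaturallyHomotopic I (AnyPath.mk (c.path i j h)) (AnyPath.mk (c'.path i j h))

/-- The set of `n`-cells: the `n`-tuples `(σ̃₁, …, σ̃ₙ)` of natural homotopy classes of
composable nonstationary paths `σ₁, …, σₙ` with `σ₁ ⋯ σₙ ∉ I`. For `n = 0` these are the
vertices. -/
def Cell (n : ℕ) : Type (max u v) :=
  Quot fun c c' : {c : PathChain Q n // c.IsCellChain I} => c.1.Homotopic I c'.1

/-- The face map `∂ⱼ` from `(n+1)`-cells to `n`-cells. -/
def Cell.face {n : ℕ} (j : Fin (n + 2)) : Cell I (n + 1) → Cell I n :=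
  Quot.map (fun c => ⟨c.1.face j, c.2.face I j⟩) fun _ _ h _ _ _ => h _ _ _

end Cells

/-! ### The classifying space -/

section ClassifyingSpace

variable {k : Type w} [Field k] {Q : Type u} [Quiver.{v} Q] (I : PathIdeal k Q)

/-- The disjoint union of one copy of the standard simplex `Δⁿ` for every `n`-cell. -/
abbrev CellSum : Type (max u v) :=
  Σ c : (Σ n : ℕ, Cell I n), stdSimplex ℝ (Fin (c.1 + 1))

/-- The gluing: the `j`-th face `{t_j = 0}` of the simplex of a cell `σ` is identified with the
simplex of `∂ⱼ σ`. -/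
inductive CellSum.Glue : CellSum I → CellSum I → Prop
  | intro (n : ℕ) (c : Cell I (n + 1)) (j : Fin (n + 2)) (t : stdSimplex ℝ (Fin (n + 1))) :
      CellSum.Glue ⟨⟨n, c.face I j⟩, t⟩ ⟨⟨n + 1, c⟩, stdSimplex.map j.succAbove t⟩

/-- The classifying space `ℬ(Q,I)`: the CW-complex with the given cells, obtained from the
disjoint union of their simplices by the gluing of faces, with the quotient topology. -/
def ClassifyingSpace : Type (max u v) :=
  Quot (CellSum.Glue I)

instance : TopologicalSpace (ClassifyingSpace I) :=
  inferInstanceAs (TopologicalSpace (Quot (CellSum.Glue I)))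

end ClassifyingSpace

/-! ### Coverings of bound quivers -/

section Coverings

variable {k : Type w} [Field k] {Q' : Type u'} [Quiver.{v'} Q'] {Q : Type u} [Quiver.{v} Q]

/-- The map induced on paths by a morphism of quivers. -/
def AnyPath.map (p : Q' ⥤q Q) (s : AnyPath Q') : AnyPath Q :=
  AnyPath.mk (p.mapPath s.2.2)

/-- The `k`-linear map `kQ' → kQ` induced by a morphism of quivers. -/
noncomputable def PathAlgebra.map (k : Type w) [Field k] (p : Q' ⥤q Q) :
    PathAlgebra k Q' →ₗ[k] PathAlgebra k Q :=
  Finsupp.lmapDomain k k (AnyPath.map p)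

/-- A morphism of bound quivers `(Q',I') → (Q,I)`: a morphism of quivers which maps `I'`
into `I`. -/
def IsBoundQuiverMorphism (I' : PathIdeal k Q') (I : PathIdeal k Q) (p : Q' ⥤q Q) : Prop :=
  ∀ a ∈ I', PathAlgebra.map k p a ∈ I

/-- A covering morphism of bound quivers. -/
structure IsCoveringMorphism (I' : PathIdeal k Q') (I : PathIdeal k Q) (p : Q' ⥤q Q) :
    Prop where
  isMorphism : IsBoundQuiverMorphism I' I p
  /-- The fibre of every vertex is nonempty. -/
  surjective : Function.Surjective p.obj
  /-- `p` induces bijections between the arrows leaving (entering) a vertex and the arrows leaving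
  (entering) its image. -/
  isCovering : p.IsCovering
  /-- Relations lift. -/
  lift_relation : ∀ (x y : Q) (ρ : PathAlgebra k Q), ρ ∈ I → ρ ∈ PathAlgebra.homSpace k x y →
    ∀ x' : Q', p.obj x' = x → ∃ y' : Q', p.obj y' = y ∧ ∃ ρ' : PathAlgebra k Q',
      ρ' ∈ I' ∧ ρ' ∈ PathAlgebra.homSpace k x' y' ∧ PathAlgebra.map k p ρ' = ρ

/-- An endomorphism of the bound quiver `(Q,I)`. -/
@[ext]
structure BoundQuiverEnd (I : PathIdeal k Q) where
  toPrefunctor : Q ⥤q Q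
  isMorphism : IsBoundQuiverMorphism I I toPrefunctor

theorem AnyPath.map_id (s : AnyPath Q) : AnyPath.map (𝟭q Q) s = s := by
  obtain ⟨x, y, p⟩ := s
  simp only [AnyPath.map, Prefunctor.mapPath_id]
  rfl

theorem AnyPath.map_comp {R : Type*} [Quiver R] (p : Q' ⥤q Q) (q : Q ⥤q R) (s : AnyPath Q') :
    AnyPath.map (p ⋙q q) s = AnyPath.map q (AnyPath.map p s) := by
  obtain ⟨x, y, r⟩ := s
  simp only [AnyPath.map, Prefunctor.mapPath_comp_apply]
  rfl

/-- The monoid of endomorphisms of `(Q,I)` under composition: `f * g` is `f` after `g`. -/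
instance (I : PathIdeal k Q) : Monoid (BoundQuiverEnd I) where
  mul f g := ⟨g.toPrefunctor ⋙q f.toPrefunctor, fun a ha => by
    have h := f.isMorphism _ (g.isMorphism a ha)
    have e : AnyPath.map (g.toPrefunctor ⋙q f.toPrefunctor) =
        AnyPath.map f.toPrefunctor ∘ AnyPath.map g.toPrefunctor :=
      funext fun s => AnyPath.map_comp _ _ s
    simpa [PathAlgebra.map, e, Finsupp.lmapDomain_apply, Finsupp.mapDomain_comp] using h⟩
  one := ⟨𝟭q Q, fun a ha => by
    have e : AnyPath.map (𝟭q Q) = id := funext fun s => AnyPath.map_id s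
    simpa [PathAlgebra.map, e, Finsupp.lmapDomain_apply, Finsupp.mapDomain_id] using ha⟩
  mul_assoc _ _ _ := rfl
  one_mul _ := rfl
  mul_one _ := rfl

/-- The group of automorphisms of the bound quiver `(Q,I)`. -/
abbrev BoundQuiverAut (I : PathIdeal k Q) : Type (max u v) :=
  (BoundQuiverEnd I)ˣ

/-- The morphism of quivers underlying an automorphism of `(Q,I)`. -/
def BoundQuiverAut.toPrefunctor {I : PathIdeal k Q} (g : BoundQuiverAut I) : Q ⥤q Q :=
  g.val.toPrefunctor

/-- The map induced by a morphism of quivers on the set of all arrows. -/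
def Prefunctor.mapArrow (p : Q' ⥤q Q) (a : Quiver.Total Q') : Quiver.Total Q :=
  ⟨p.obj a.left, p.obj a.right, p.map a.hom⟩

/-- A covering morphism `p` is a Galois covering, given by a group `G` acting by automorphisms of
`(Q',I')`. -/
structure IsGaloisCovering (I' : PathIdeal k Q') (I : PathIdeal k Q) (p : Q' ⥤q Q)
    {G : Type*} [Group G] (act : G →* BoundQuiverAut I') : Prop extends
    IsCoveringMorphism I' I p where
  /-- `p g = p`. -/
  comp_eq : ∀ g : G, (act g).toPrefunctor ⋙q p = p
  /-- The fibre of a vertex is a `G`-orbit. -/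
  vertex_orbit : ∀ x y : Q', p.obj x = p.obj y → ∃ g : G, (act g).toPrefunctor.obj x = y
  /-- The fibre of an arrow is a `G`-orbit. -/
  arrow_orbit : ∀ a b : Quiver.Total Q', p.mapArrow a = p.mapArrow b →
    ∃ g : G, (act g).toPrefunctor.mapArrow a = b
  /-- `G` acts without fixed points. -/
  free : ∀ (g : G) (x : Q'), (act g).toPrefunctor.obj x = x → g = 1

end Coverings

/-! ### The map of classifying spaces induced by a covering morphism -/

section InducedMap

variable {k : Type w} [Field k] {Q' : Type u'} [Quiver.{v'} Q'] {Q : Type u} [Quiver.{v} Q]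
  {I' : PathIdeal k Q'} {I : PathIdeal k Q} {p : Q' ⥤q Q}

theorem AnyPath.map_injOn (hp : p.IsCovering) (x : Q') :
    Set.InjOn (AnyPath.map p) {s : AnyPath Q' | s.1 = x} := by
  rintro ⟨x₁, y₁, s⟩ h₁ ⟨x₂, y₂, t⟩ h₂ h
  obtain rfl : x₁ = x := h₁
  obtain rfl : x₂ = x₁ := h₂
  have h' := eq_of_heq (Sigma.mk.inj h).2
  have := (hp.pathStar_bijective x₂).1 (a₁ := ⟨y₁, s⟩) (a₂ := ⟨y₂, t⟩) h'
  rw [this]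

theorem PathAlgebra.homSpace_subset {x y : Q'} {a : PathAlgebra k Q'}
    (ha : a ∈ PathAlgebra.homSpace k x y) : (a.support : Set (AnyPath Q')) ⊆ {s | s.1 = x} :=
  fun _ hs => ((Finsupp.mem_supported k a).1 ha hs).1

theorem PathAlgebra.map_mem_homSpace {x y : Q'} {a : PathAlgebra k Q'}
    (ha : a ∈ PathAlgebra.homSpace k x y) :
    PathAlgebra.map k p a ∈ PathAlgebra.homSpace k (p.obj x) (p.obj y) := by
  classical
  refine (Finsupp.mem_supported k _).2 fun s hs => ?_
  obtain ⟨t, ht, rfl⟩ := Finset.mem_image.1 (Finsupp.mapDomain_support hs)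
  obtain ⟨h₁, h₂⟩ := (Finsupp.mem_supported k a).1 ha ht
  exact ⟨congrArg p.obj h₁, congrArg p.obj h₂⟩

/-- An element of `kQ'(x,y)` lies in `I'` if its image lies in `I`. -/
theorem IsCoveringMorphism.mem_of_map_mem (hp : IsCoveringMorphism I' I p) {x y : Q'}
    {a : PathAlgebra k Q'} (ha : a ∈ PathAlgebra.homSpace k x y)
    (h : PathAlgebra.map k p a ∈ I) : a ∈ I' := by
  obtain ⟨y', -, b, hb, hb', e⟩ := hp.lift_relation _ _ _ h
    (PathAlgebra.map_mem_homSpace ha) x rfl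
  have : b = a := Finsupp.mapDomain_injOn _ (AnyPath.map_injOn hp.isCovering x)
    (PathAlgebra.homSpace_subset hb') (PathAlgebra.homSpace_subset ha) e
  rwa [← this]

theorem PathAlgebra.map_apply_of_mem (hp : p.IsCovering) {x y : Q'} {a : PathAlgebra k Q'}
    (ha : a ∈ PathAlgebra.homSpace k x y) {s : AnyPath Q'} (hs : s.1 = x) :
    PathAlgebra.map k p a (AnyPath.map p s) = a s :=
  Finsupp.mapDomain_apply' _ a (PathAlgebra.homSpace_subset ha) (AnyPath.map_injOn hp x) hs

/-- Covering morphisms map minimal relations to minimal relations. -/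
theorem IsCoveringMorphism.map_isMinimalRelation (hp : IsCoveringMorphism I' I p) {x y : Q'}
    {ρ : PathAlgebra k Q'} (hρ : IsMinimalRelation I' x y ρ) :
    IsMinimalRelation I (p.obj x) (p.obj y) (PathAlgebra.map k p ρ) := by
  classical
  obtain ⟨h₁, h₂, h₃, h₄⟩ := hρ
  have hinj := AnyPath.map_injOn hp.isCovering x
  have hsub := PathAlgebra.homSpace_subset h₂
  have hsf : ∀ (P : AnyPath Q' → Prop) [DecidablePred P] (s : AnyPath Q'),
      s ∈ (ρ.filter P).support → s ∈ ρ.support := fun P _ s hs => by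
    rw [Finsupp.support_filter] at hs
    exact (Finset.mem_filter.1 hs).1
  have hsupp : (PathAlgebra.map k p ρ).support = ρ.support.image (AnyPath.map p) :=
    Finsupp.mapDomain_support_of_injOn ρ (hinj.mono hsub)
  refine ⟨hp.isMorphism _ h₁, PathAlgebra.map_mem_homSpace h₂, ?_, fun J hJ hne hmem => ?_⟩
  · rwa [hsupp, Finset.card_image_of_injOn (hinj.mono hsub)]
  · set K := ρ.support.filter fun s => AnyPath.map p s ∈ J with hK
    have hfil : PathAlgebra.map k p (ρ.filter (· ∈ K)) =
        (PathAlgebra.map k p ρ).filter (· ∈ J) := by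
      have e₁ : ρ.filter (· ∈ K) = ρ.filter fun s => AnyPath.map p s ∈ J := by
        ext s
        by_cases hs : ρ s = 0
        · simp [Finsupp.filter_apply, hs]
        · simp [Finsupp.filter_apply, hK, hs]
      rw [e₁]
      ext t
      by_cases ht : ∃ s ∈ ρ.support, AnyPath.map p s = t
      · obtain ⟨s, hs, rfl⟩ := ht
        have h₂' : (ρ.filter fun s => AnyPath.map p s ∈ J) ∈ PathAlgebra.homSpace k x y :=
          (Finsupp.mem_supported k _).2 fun r hr =>
            (Finsupp.mem_supported k ρ).1 h₂ (hsf _ r hr)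
        rw [PathAlgebra.map_apply_of_mem hp.isCovering h₂' (hsub hs)]
        simp only [Finsupp.filter_apply]
        rw [PathAlgebra.map_apply_of_mem hp.isCovering h₂ (hsub hs)]
      · have z₁ : t ∉ (PathAlgebra.map k p ρ).support := by
          rw [hsupp]
          simpa using ht
        have z₂ : t ∉ (PathAlgebra.map k p
            (ρ.filter fun s => AnyPath.map p s ∈ J)).support := fun h => by
          obtain ⟨s, hs, e⟩ := Finset.mem_image.1 (Finsupp.mapDomain_support h)
          exact ht ⟨s, hsf _ s hs, e⟩
        rw [Finsupp.notMem_support_iff] at z₁ z₂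
        rw [z₂, Finsupp.filter_apply, z₁, ite_self]
    have hKJ : K.image (AnyPath.map p) = J := by
      ext t
      simp only [hK, Finset.mem_image, Finset.mem_filter]
      constructor
      · rintro ⟨s, ⟨-, h⟩, rfl⟩
        exact h
      · intro h
        have := hJ.1 h
        rw [hsupp] at this
        obtain ⟨s, hs, rfl⟩ := Finset.mem_image.1 this
        exact ⟨s, ⟨hs, h⟩, rfl⟩
    refine h₄ K ⟨Finset.filter_subset _ _, fun h => hJ.2 ?_⟩ ?_ ?_
    · rw [hsupp, ← hKJ]
      exact Finset.image_subset_image h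
    · rw [← hKJ] at hne
      exact Finset.image_nonempty.1 hne
    · refine hp.mem_of_map_mem (x := x) (y := y) ?_ (by rwa [hfil])
      exact (Finsupp.mem_supported k _).2 fun r hr =>
        (Finsupp.mem_supported k ρ).1 h₂ (hsf _ r hr)

/-- Covering morphisms preserve natural homotopy. -/
theorem IsCoveringMorphism.map_naturallyHomotopic (hp : IsCoveringMorphism I' I p)
    {s t : AnyPath Q'} (h : NaturallyHomotopic I' s t) :
    NaturallyHomotopic I (AnyPath.map p s) (AnyPath.map p t) := by
  classical
  induction h with
  | rel _ _ h =>
    obtain ⟨u, v, v', w, ρ, hρ, hv, hv'⟩ := h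
    have hsupp : ∀ s ∈ ρ.support, AnyPath.map p s ∈ (PathAlgebra.map k p ρ).support := by
      intro s hs
      rw [Finsupp.mem_support_iff, PathAlgebra.map_apply_of_mem hp.isCovering hρ.2.1
        (PathAlgebra.homSpace_subset hρ.2.1 hs)]
      exact Finsupp.mem_support_iff.1 hs
    simp only [AnyPath.map, Prefunctor.mapPath_comp]
    exact .rel _ _ (.intro _ _ _ _ _ (hp.map_isMinimalRelation hρ) (hsupp _ hv) (hsupp _ hv'))
  | refl _ => exact .refl _
  | symm _ _ _ ih => exact .symm _ _ ih
  | trans _ _ _ _ _ ih₁ ih₂ => exact .trans _ _ _ ih₁ ih₂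

/-- The image of a sequence of composable paths under a morphism of quivers. -/
def PathChain.map (p : Q' ⥤q Q) {n : ℕ} (c : PathChain Q' n) : PathChain Q n where
  vertex i := p.obj (c.vertex i)
  path i j h := p.mapPath (c.path i j h)
  path_self i := by rw [c.path_self, Prefunctor.mapPath_nil]
  path_comp i j l hij hjl := by rw [← Prefunctor.mapPath_comp, c.path_comp]

theorem AnyPath.length_map {x y : Q'} (s : Quiver.Path x y) :
    (p.mapPath s).length = s.length := by
  induction s with
  | nil => rfl
  | cons s e ih => simp [ih]

theorem IsCoveringMorphism.map_isCellChain (hp : IsCoveringMorphism I' I p) {n : ℕ}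
    {c : PathChain Q' n} (hc : c.IsCellChain I') : (c.map p).IsCellChain I where
  length_pos i j h := (hc.length_pos i j h).trans_eq (AnyPath.length_map _).symm
  total_notMem h := by
    refine hc.total_notMem (hp.mem_of_map_mem (x := c.vertex 0) (y := c.vertex (Fin.last n)) ?_ ?_)
    · exact Finsupp.single_mem_supported k 1 ⟨rfl, rfl⟩
    · rw [PathAlgebra.map, PathAlgebra.ofPath, Finsupp.lmapDomain_apply, Finsupp.mapDomain_single]
      exact h

/-- The map on cells `(σ̃₁, …, σ̃ₙ) ↦ (p(σ₁)~, …, p(σₙ)~)`. -/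
def Cell.map (hp : IsCoveringMorphism I' I p) {n : ℕ} : Cell I' n → Cell I n :=
  Quot.map (fun c => ⟨c.1.map p, hp.map_isCellChain c.2⟩)
    fun _ _ h i j hij => hp.map_naturallyHomotopic (h i j hij)

theorem Cell.map_face (hp : IsCoveringMorphism I' I p) {n : ℕ} (j : Fin (n + 2))
    (c : Cell I' (n + 1)) : Cell.map hp (c.face I' j) = (Cell.map hp c).face I j := by
  induction c using Quot.ind
  rfl

/-- The map `ℬp : ℬ(Q',I') → ℬ(Q,I)` induced by a covering morphism `p`, which maps the simplex of
a cell `(σ̃₁, …, σ̃ₙ)` identically onto the simplex of the cell `(p(σ₁)~, …, p(σₙ)~)`. -/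
def classifyingMap (hp : IsCoveringMorphism I' I p) :
    C(ClassifyingSpace I', ClassifyingSpace I) where
  toFun := Quot.map (fun z => ⟨⟨z.1.1, Cell.map hp z.1.2⟩, z.2⟩) (by
    rintro _ _ ⟨n, c, j, t⟩
    dsimp only
    rw [Cell.map_face]
    exact .intro n _ j t)
  continuous_toFun := by
    refine continuous_quot_lift _ (continuous_quot_mk.comp (continuous_sigma fun c => ?_))
    exact continuous_sigmaMk (σ := fun c : (Σ n : ℕ, Cell I n) => stdSimplex ℝ (Fin (c.1 + 1)))
      (i := ⟨c.1, Cell.map hp c.2⟩)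

end InducedMap

/-! ### Regular coverings of topological spaces -/

section RegularCoverings

/-- The map `f : X' → X` makes `X'` a regular covering space of `X`: `X'` is path connected, `f`
is a (surjective) covering map, and the image of `f_* : π₁(X',x) → π₁(X,f(x))` is a normal
subgroup for every base point `x`. -/
structure IsRegularCovering {X' : Type*} {X : Type*} [TopologicalSpace X'] [TopologicalSpace X]
    (f : C(X', X)) : Prop where
  pathConnected : PathConnectedSpace X'
  isCoveringMap : IsCoveringMap f
  surjective : Function.Surjective f
  normal_range : ∀ x : X', (FundamentalGroup.map f x).range.Normal

/-- The group of covering automorphisms of `f : X' → X`: the homeomorphisms `φ` of `X'` with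
`f ∘ φ = f`, under composition. -/
def coveringAutomorphisms {X' : Type*} {X : Type*} [TopologicalSpace X'] [TopologicalSpace X]
    (f : C(X', X)) : Subgroup (X' ≃ₜ X') where
  carrier := {φ | ∀ x, f (φ x) = f x}
  mul_mem' {φ ψ} hφ hψ x := (hφ (ψ x)).trans (hψ x)
  one_mem' _ := rfl
  inv_mem' {φ} hφ x := by
    have := hφ (φ⁻¹ x)
    rw [← this]
    exact congrArg f (φ.apply_symm_apply x)

end RegularCoverings

-- The group `G` acts on ℬ(Q',I') through the maps induced by its automorphisms, and the theorem
-- follows once ℬp is shown to be the quotient covering map of this action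
-- (`IsGaloisCovering.isQuotientCoveringMap`).
--
-- Algebraically, everything rests on unique path lifting. Relations lift, so covering morphisms
-- reflect minimal relations, and natural homotopies lift too
-- (`IsCoveringMorphism.exists_lift_naturallyHomotopic`). Hence every cell lifts, and a lift is
-- determined by its initial vertex (`Cell.eq_of_map_eq`). As `G` is simply transitive on vertex
-- fibres, it is simply transitive on the cells above a given cell. The gluing relation then lifts,
-- so the fibres of ℬp are the `G`-orbits.
--
-- Topologically, ℬp is a quotient map because it comes from an open surjection of disjoint unions
-- of simplices. For evenly covered neighbourhoods, use open stars of barycentres of cells in the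
-- barycentric subdivision. They cover the space, distinct cells of the same dimension have disjoint
-- stars (`Cell.eq_of_mem_openStar`), and an element of `G` carries the star of a cell into the star
-- of its image. A star meeting its own translate therefore forces the group element to fix a cell,
-- hence a vertex, hence to be 1.
--
-- Path connectedness comes from the 1-cells of the arrows. The rest is covering theory: the image
-- of π₁ is the kernel of monodromy, and a covering automorphism of a connected space is determined
-- by the image of one point.

universe u'' v''

/-! ### Lifting paths, minimal relations and natural homotopies -/

section QuiverCoverings

variable {k : Type w} [Field k] {Q' : Type u'} [Quiver.{v'} Q'] {Q : Type u} [Quiver.{v} Q]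
  {I' : PathIdeal k Q'} {I : PathIdeal k Q} {p : Q' ⥤q Q}

/-- Equalities of paths are stated in `AnyPath` throughout, so that endpoints which agree only
propositionally need no casts. -/
theorem AnyPath.mk_comp_congr {a x b a₁ x₁ b₁ : Q} {s : Quiver.Path a x} {t : Quiver.Path x b}
    {s₁ : Quiver.Path a₁ x₁} {t₁ : Quiver.Path x₁ b₁} (hs : AnyPath.mk s = AnyPath.mk s₁)
    (ht : AnyPath.mk t = AnyPath.mk t₁) : AnyPath.mk (s.comp t) = AnyPath.mk (s₁.comp t₁) := by
  cases hs
  cases ht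
  rfl

theorem AnyPath.map_comp_eq {a' x' b' : Q'} {a x b : Q} {s' : Quiver.Path a' x'}
    {t' : Quiver.Path x' b'} {s : Quiver.Path a x} {t : Quiver.Path x b}
    (hs : AnyPath.map p (AnyPath.mk s') = AnyPath.mk s)
    (ht : AnyPath.map p (AnyPath.mk t') = AnyPath.mk t) :
    AnyPath.map p (AnyPath.mk (s'.comp t')) = AnyPath.mk (s.comp t) := by
  simp only [AnyPath.map, Prefunctor.mapPath_comp] at hs ht ⊢
  exact AnyPath.mk_comp_congr hs ht

theorem AnyPath.length_eq_of_map_eq {x' y' : Q'} {x y : Q} {s' : Quiver.Path x' y'}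
    {s : Quiver.Path x y} (h : AnyPath.map p (AnyPath.mk s') = AnyPath.mk s) :
    s'.length = s.length := by
  rw [← AnyPath.length_map (p := p) s']
  exact congrArg (fun r : AnyPath Q => r.2.2.length) h

/-- Paths lift along coverings. -/
theorem AnyPath.exists_lift (hp : p.IsCovering) {x' : Q'} {x y : Q} (hx : p.obj x' = x)
    (s : Quiver.Path x y) :
    ∃ (y' : Q') (s' : Quiver.Path x' y'), AnyPath.map p (AnyPath.mk s') = AnyPath.mk s := by
  subst hx
  obtain ⟨⟨y', s'⟩, h⟩ := (hp.pathStar_bijective x').2 ⟨y, s⟩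
  exact ⟨y', s', congrArg (Sigma.mk (p.obj x')) h⟩

theorem AnyPath.eq_of_map_eq (hp : p.IsCovering) {s t : AnyPath Q'} (hst : s.1 = t.1)
    (h : AnyPath.map p s = AnyPath.map p t) : s = t :=
  AnyPath.map_injOn hp t.1 hst rfl h

theorem NaturalHomotopyStep.symm {s t : AnyPath Q} (h : NaturalHomotopyStep I s t) :
    NaturalHomotopyStep I t s := by
  obtain ⟨u, v, v', w, ρ, hρ, hv, hv'⟩ := h
  exact .intro u v' v w ρ hρ hv' hv

theorem NaturallyHomotopic.endpoints_eq {s t : AnyPath Q} (h : NaturallyHomotopic I s t) :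
    s.1 = t.1 ∧ s.2.1 = t.2.1 := by
  induction h with
  | rel _ _ h =>
    obtain ⟨u, v, v', w, ρ, hρ, hv, hv'⟩ := h
    exact ⟨rfl, rfl⟩
  | refl _ => exact ⟨rfl, rfl⟩
  | symm _ _ _ ih => exact ⟨ih.1.symm, ih.2.symm⟩
  | trans _ _ _ _ _ ih₁ ih₂ => exact ⟨ih₁.1.trans ih₂.1, ih₁.2.trans ih₂.2⟩

/-- Covering morphisms reflect minimal relations. -/
theorem IsCoveringMorphism.isMinimalRelation_of_map (hp : IsCoveringMorphism I' I p) {x' y' : Q'}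
    {x y : Q} {ρ' : PathAlgebra k Q'} (hρ' : ρ' ∈ PathAlgebra.homSpace k x' y')
    (h : IsMinimalRelation I x y (PathAlgebra.map k p ρ')) : IsMinimalRelation I' x' y' ρ' := by
  classical
  obtain ⟨h₁, -, h₃, h₄⟩ := h
  have hsub := PathAlgebra.homSpace_subset hρ'
  have hinj := (AnyPath.map_injOn hp.isCovering x').mono hsub
  have hsupp : (PathAlgebra.map k p ρ').support = ρ'.support.image (AnyPath.map p) :=
    Finsupp.mapDomain_support_of_injOn ρ' hinj
  refine ⟨hp.mem_of_map_mem hρ' h₁, hρ', ?_, fun J hJ hne hmem => ?_⟩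
  · rw [hsupp] at h₃
    exact h₃.trans Finset.card_image_le
  · have hJs : ρ'.filter (· ∈ J) ∈ PathAlgebra.homSpace k x' y' :=
      (Finsupp.mem_supported k _).2 fun r hr => (Finsupp.mem_supported k ρ').1 hρ' <| by
        rw [Finsupp.support_filter] at hr
        exact (Finset.mem_filter.1 hr).1
    have hfil : PathAlgebra.map k p (ρ'.filter (· ∈ J)) =
        (PathAlgebra.map k p ρ').filter (· ∈ J.image (AnyPath.map p)) := by
      ext t
      by_cases ht : ∃ s ∈ ρ'.support, AnyPath.map p s = t
      · obtain ⟨s, hs, rfl⟩ := ht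
        rw [PathAlgebra.map_apply_of_mem hp.isCovering hJs (hsub hs), Finsupp.filter_apply,
          Finsupp.filter_apply, PathAlgebra.map_apply_of_mem hp.isCovering hρ' (hsub hs)]
        have : AnyPath.map p s ∈ J.image (AnyPath.map p) ↔ s ∈ J := by
          refine ⟨fun h => ?_, Finset.mem_image_of_mem _⟩
          obtain ⟨r, hr, e⟩ := Finset.mem_image.1 h
          rwa [← hinj (hJ.1 hr) hs e]
        simp only [this]
      · have z₁ : t ∉ (PathAlgebra.map k p ρ').support := by
          rw [hsupp]
          simpa using ht
        have z₂ : t ∉ (PathAlgebra.map k p (ρ'.filter (· ∈ J))).support := fun h => by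
          obtain ⟨s, hs, e⟩ := Finset.mem_image.1 (Finsupp.mapDomain_support h)
          rw [Finsupp.support_filter] at hs
          exact ht ⟨s, (Finset.mem_filter.1 hs).1, e⟩
        rw [Finsupp.notMem_support_iff] at z₁ z₂
        rw [z₂, Finsupp.filter_apply, z₁, ite_self]
    -- The image of `J` remains a proper subset because `p` is injective on the support: the
    -- cardinalities differ.
    refine h₄ (J.image (AnyPath.map p)) ?_ (hne.image _) ?_
    · rw [hsupp, Finset.ssubset_iff_subset_ne]
      refine ⟨Finset.image_subset_image hJ.1, fun e => ?_⟩
      have := congrArg Finset.card e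
      rw [Finset.card_image_of_injOn hinj,
        Finset.card_image_of_injOn (hinj.mono (Finset.coe_subset.2 hJ.1))] at this
      exact (Finset.card_lt_card hJ).ne this
    · rw [← hfil]
      exact hp.isMorphism _ hmem

/-- Lift `u` from the source of `s'`, then the whole relation `ρ` from the end of that lift. All
terms of the lifted relation are parallel, so the lifts of `v` and `v₁` end at the same vertex and
one lift of `w` continues both. -/
theorem IsCoveringMorphism.exists_lift_step (hp : IsCoveringMorphism I' I p) {s' : AnyPath Q'}
    {s t : AnyPath Q} (h : NaturalHomotopyStep I s t) (hs : AnyPath.map p s' = s) :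
    ∃ t', NaturallyHomotopic I' s' t' ∧ AnyPath.map p t' = t := by
  classical
  obtain ⟨u, v, v₁, w, ρ, hρ, hv, hv₁⟩ := h
  obtain ⟨x', u', hu'⟩ := AnyPath.exists_lift hp.isCovering (congrArg Sigma.fst hs) u
  obtain ⟨y', -, ρ', -, hhom, rfl⟩ := hp.lift_relation _ _ ρ hρ.1 hρ.2.1 x'
    (congrArg (fun r : AnyPath Q => r.2.1) hu')
  have hρ' := hp.isMinimalRelation_of_map hhom hρ
  obtain ⟨⟨x₂, y₂, r⟩, hr, er⟩ := Finset.mem_image.1 (Finsupp.mapDomain_support hv)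
  obtain ⟨⟨x₃, y₃, r₁⟩, hr₁, er₁⟩ := Finset.mem_image.1 (Finsupp.mapDomain_support hv₁)
  obtain ⟨hx₂, hy₂⟩ := (Finsupp.mem_supported k ρ').1 hhom hr
  obtain ⟨hx₃, hy₃⟩ := (Finsupp.mem_supported k ρ').1 hhom hr₁
  dsimp only at hx₂ hy₂ hx₃ hy₃
  subst x₂ y₂ x₃ y₃
  obtain ⟨b', w', hw'⟩ := AnyPath.exists_lift hp.isCovering
    (congrArg (fun r : AnyPath Q => r.2.1) er) w
  -- Unique path lifting: both sides start at the same vertex and lie over `s`.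
  have e : s' = AnyPath.mk (u'.comp (r.comp w')) :=
    AnyPath.eq_of_map_eq hp.isCovering rfl
      (hs.trans (AnyPath.map_comp_eq hu' (AnyPath.map_comp_eq er hw')).symm)
  refine ⟨AnyPath.mk (u'.comp (r₁.comp w')), ?_,
    AnyPath.map_comp_eq hu' (AnyPath.map_comp_eq er₁ hw')⟩
  refine .trans _ (AnyPath.mk (u'.comp (r.comp w'))) _ ?_
    (.rel _ _ (.intro u' r r₁ w' ρ' hρ' hr hr₁))
  rw [← e]
  exact .refl _

/-- Natural homotopies lift along covering morphisms. -/
theorem IsCoveringMorphism.exists_lift_naturallyHomotopic (hp : IsCoveringMorphism I' I p)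
    {s t : AnyPath Q} (h : NaturallyHomotopic I s t) :
    (∀ s', AnyPath.map p s' = s → ∃ t', NaturallyHomotopic I' s' t' ∧ AnyPath.map p t' = t) ∧
      ∀ t', AnyPath.map p t' = t → ∃ s', NaturallyHomotopic I' t' s' ∧ AnyPath.map p s' = s := by
  induction h with
  | rel _ _ h => exact ⟨fun _ => hp.exists_lift_step h, fun _ => hp.exists_lift_step h.symm⟩
  | refl _ => exact ⟨fun s' hs => ⟨s', .refl _, hs⟩, fun s' hs => ⟨s', .refl _, hs⟩⟩
  -- Both directions are carried through the induction for the sake of this case, which interchanges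
  -- them.
  | symm _ _ _ ih => exact ih.symm
  | trans _ _ _ _ _ ih₁ ih₂ =>
    constructor
    · intro s' hs
      obtain ⟨t', h₁, ht⟩ := ih₁.1 s' hs
      obtain ⟨r', h₂, hr⟩ := ih₂.1 t' ht
      exact ⟨r', .trans _ _ _ h₁ h₂, hr⟩
    · intro s' hs
      obtain ⟨t', h₁, ht⟩ := ih₂.2 s' hs
      obtain ⟨r', h₂, hr⟩ := ih₁.2 t' ht
      exact ⟨r', .trans _ _ _ h₁ h₂, hr⟩

/-- Covering morphisms reflect natural homotopy of paths with the same source. -/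
theorem IsCoveringMorphism.naturallyHomotopic_of_map (hp : IsCoveringMorphism I' I p)
    {s t : AnyPath Q'} (hst : s.1 = t.1)
    (h : NaturallyHomotopic I (AnyPath.map p s) (AnyPath.map p t)) : NaturallyHomotopic I' s t := by
  obtain ⟨t', ht', e⟩ := (hp.exists_lift_naturallyHomotopic h).1 s rfl
  rwa [← AnyPath.eq_of_map_eq hp.isCovering (ht'.endpoints_eq.1.symm.trans hst) e]

/-! ### Chains of paths -/

theorem PathChain.ext_mk {n : ℕ} {c c' : PathChain Q n}
    (h : ∀ i j hij, AnyPath.mk (c.path i j hij) = AnyPath.mk (c'.path i j hij)) : c = c' := by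
  obtain ⟨x, s, _, _⟩ := c
  obtain ⟨x', s', _, _⟩ := c'
  obtain rfl : x = x' := funext fun i => congrArg Sigma.fst (h i i le_rfl)
  obtain rfl : s = s' := by
    funext i j hij
    simpa using h i j hij
  rfl

theorem PathChain.Homotopic.vertex_eq {n : ℕ} {c c' : PathChain Q n} (h : c.Homotopic I c')
    (i : Fin (n + 1)) : c.vertex i = c'.vertex i :=
  (h i i le_rfl).endpoints_eq.1

/-- Homotopy of chains is already an equivalence relation, so equality of cells means homotopy of
representatives, with no chain of intermediate steps. -/
theorem PathChain.equivalence_homotopic (n : ℕ) :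
    Equivalence fun c c' : {c : PathChain Q n // c.IsCellChain I} => c.1.Homotopic I c'.1 where
  refl _ _ _ _ := .refl _
  symm h i j hij := .symm _ _ (h i j hij)
  trans h h' i j hij := .trans _ _ _ (h i j hij) (h' i j hij)

theorem Cell.mk_eq_mk_iff {n : ℕ} {c c' : {c : PathChain Q n // c.IsCellChain I}} :
    (Quot.mk _ c : Cell I n) = Quot.mk _ c' ↔ c.1.Homotopic I c'.1 :=
  (PathChain.equivalence_homotopic (I := I) n).quot_mk_eq_iff c c'

/-- Chains of paths lift along coverings. -/
theorem PathChain.exists_map_eq (hp : p.IsCovering) {n : ℕ} (c : PathChain Q n) {x' : Q'}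
    (hx' : p.obj x' = c.vertex 0) : ∃ c' : PathChain Q' n, c'.map p = c := by
  -- Only the initial segments are lifted, all from `x'`; their endpoints `y i` are the vertices of
  -- the lifted chain.
  choose y q hq using fun i => AnyPath.exists_lift hp hx' (c.path 0 i (Fin.zero_le _))
  have key (i j : Fin (n + 1)) (hij : i ≤ j) :
      ∃ r : Quiver.Path (y i) (y j),
        AnyPath.map p (AnyPath.mk r) = AnyPath.mk (c.path i j hij) := by
    obtain ⟨z, r, hr⟩ := AnyPath.exists_lift hp
      (congrArg (fun r : AnyPath Q => r.2.1) (hq i)) (c.path i j hij)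
    -- Both paths lift the segment from 0 to `j` with source `x'`, so they agree; in particular `r`
    -- ends at `y j`.
    have e : AnyPath.mk ((q i).comp r) = AnyPath.mk (q j) := by
      refine AnyPath.eq_of_map_eq hp rfl ?_
      rw [hq j, ← c.path_comp 0 i j (Fin.zero_le _) hij]
      exact AnyPath.map_comp_eq (hq i) hr
    obtain rfl : z = y j := congrArg (fun r : AnyPath Q' => r.2.1) e
    exact ⟨r, hr⟩
  choose r hr using key
  refine ⟨⟨y, r, fun i => Quiver.Path.eq_nil_of_length_zero _ ?_, fun i j l hij hjl => ?_⟩,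
    PathChain.ext_mk hr⟩
  · rw [AnyPath.length_eq_of_map_eq (hr i i le_rfl), c.path_self]
    rfl
  · have := AnyPath.eq_of_map_eq hp (s := AnyPath.mk ((r i j hij).comp (r j l hjl)))
      (t := AnyPath.mk (r i l (hij.trans hjl))) rfl <| by
        rw [hr, ← c.path_comp i j l hij hjl]
        exact AnyPath.map_comp_eq (hr i j hij) (hr j l hjl)
    simpa using this

theorem IsCoveringMorphism.isCellChain_of_map (hp : IsCoveringMorphism I' I p) {n : ℕ}
    {c : PathChain Q' n} (hc : (c.map p).IsCellChain I) : c.IsCellChain I' where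
  length_pos i j h := (hc.length_pos i j h).trans_eq (AnyPath.length_map _)
  total_notMem h := by
    have := hp.isMorphism _ h
    rw [PathAlgebra.map, PathAlgebra.ofPath, Finsupp.lmapDomain_apply,
      Finsupp.mapDomain_single] at this
    exact hc.total_notMem this

theorem Cell.map_surjective (hp : IsCoveringMorphism I' I p) {n : ℕ} :
    Function.Surjective (Cell.map hp (n := n)) := by
  rintro ⟨c, hc⟩
  obtain ⟨x', hx'⟩ := hp.surjective (c.vertex 0)
  obtain ⟨c', rfl⟩ := c.exists_map_eq hp.isCovering hx'
  exact ⟨Quot.mk _ ⟨c', hp.isCellChain_of_map hc⟩, rfl⟩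

/-- The initial vertex of a cell. -/
def Cell.source {n : ℕ} : Cell I n → Q :=
  Quot.lift (fun c => c.1.vertex 0) fun _ _ h => h.vertex_eq 0

/-- The initial segments of the two chains have a common source, so their homotopies are reflected
and their ends agree. Thus all vertices agree, and the homotopies of the remaining segments are
reflected as well. -/
theorem Cell.eq_of_map_eq (hp : IsCoveringMorphism I' I p) {n : ℕ} {c c' : Cell I' n}
    (hs : c.source = c'.source) (h : Cell.map hp c = Cell.map hp c') : c = c' := by
  induction c using Quot.ind with | mk c =>
  induction c' using Quot.ind with | mk c' =>
  have h' : (c.1.map p).Homotopic I (c'.1.map p) := Cell.mk_eq_mk_iff.1 h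
  have h₀ (j : Fin (n + 1)) := hp.naturallyHomotopic_of_map
    (s := AnyPath.mk (c.1.path 0 j (Fin.zero_le _)))
    (t := AnyPath.mk (c'.1.path 0 j (Fin.zero_le _))) hs (h' 0 j (Fin.zero_le _))
  exact Cell.mk_eq_mk_iff.2 fun i j hij => hp.naturallyHomotopic_of_map
    (s := AnyPath.mk (c.1.path i j hij)) (t := AnyPath.mk (c'.1.path i j hij))
    (h₀ i).endpoints_eq.2 (h' i j hij)

end QuiverCoverings

/-! ### Functoriality of the classifying space, and ℬp as a quotient map -/

section ClassifyingMaps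

variable {k : Type w} [Field k] {Q'' : Type u''} [Quiver.{v''} Q''] {Q' : Type u'} [Quiver.{v'} Q']
  {Q : Type u} [Quiver.{v} Q] {I'' : PathIdeal k Q''} {I' : PathIdeal k Q'} {I : PathIdeal k Q}
  {p : Q' ⥤q Q} {q : Q'' ⥤q Q'} {r : Q'' ⥤q Q}

theorem PathChain.map_map {n : ℕ} (c : PathChain Q'' n) :
    (c.map q).map p = c.map (q ⋙q p) := by
  refine PathChain.ext_mk fun i j hij => ?_
  simp only [PathChain.map, Prefunctor.mapPath_comp_apply]
  rfl

theorem PathChain.map_id {n : ℕ} (c : PathChain Q n) : c.map (𝟭q Q) = c :=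
  PathChain.ext_mk fun i j hij => AnyPath.map_id (AnyPath.mk (c.path i j hij))

/-- The composite is a separate morphism `r` with an equation, so that the lemma applies directly to
identities such as `p g = p`. -/
theorem Cell.map_map (hq : IsCoveringMorphism I'' I' q) (hp : IsCoveringMorphism I' I p)
    (hr : IsCoveringMorphism I'' I r) (h : q ⋙q p = r) {n : ℕ} (c : Cell I'' n) :
    Cell.map hp (Cell.map hq c) = Cell.map hr c := by
  subst h
  induction c using Quot.ind with | mk c =>
  exact congrArg (Quot.mk _) (Subtype.ext c.1.map_map)

theorem Cell.map_id (hp : IsCoveringMorphism I I (𝟭q Q)) {n : ℕ} (c : Cell I n) :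
    Cell.map hp c = c := by
  induction c using Quot.ind with | mk c =>
  exact congrArg (Quot.mk _) (Subtype.ext c.1.map_id)

theorem Cell.source_map (hp : IsCoveringMorphism I' I p) {n : ℕ} (c : Cell I' n) :
    (Cell.map hp c).source = p.obj c.source := by
  induction c using Quot.ind with | mk c =>
  rfl

/-- The point of the classifying space with barycentric coordinates `t` in the simplex of `c`. -/
def ClassifyingSpace.mk {n : ℕ} (c : Cell I n) (t : stdSimplex ℝ (Fin (n + 1))) :
    ClassifyingSpace I :=
  Quot.mk _ ⟨⟨n, c⟩, t⟩

theorem ClassifyingSpace.continuous_mk {n : ℕ} (c : Cell I n) :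
    Continuous (ClassifyingSpace.mk c) :=
  continuous_quot_mk.comp
    (continuous_sigmaMk (σ := fun c : (Σ n : ℕ, Cell I n) => stdSimplex ℝ (Fin (c.1 + 1)))
      (i := ⟨n, c⟩))

theorem ClassifyingSpace.ind {P : ClassifyingSpace I → Prop}
    (h : ∀ (n : ℕ) (c : Cell I n) (t : stdSimplex ℝ (Fin (n + 1))), P (.mk c t))
    (z : ClassifyingSpace I) : P z :=
  Quot.ind (fun x => h x.1.1 x.1.2 x.2) z

theorem ClassifyingSpace.mk_face {n : ℕ} (c : Cell I (n + 1)) (j : Fin (n + 2))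
    (t : stdSimplex ℝ (Fin (n + 1))) :
    ClassifyingSpace.mk (c.face I j) t = ClassifyingSpace.mk c (stdSimplex.map j.succAbove t) :=
  Quot.sound (.intro n c j t)

@[simp]
theorem classifyingMap_mk (hp : IsCoveringMorphism I' I p) {n : ℕ} (c : Cell I' n)
    (t : stdSimplex ℝ (Fin (n + 1))) : classifyingMap hp (.mk c t) = .mk (Cell.map hp c) t :=
  rfl

theorem classifyingMap_map (hq : IsCoveringMorphism I'' I' q) (hp : IsCoveringMorphism I' I p)
    (hr : IsCoveringMorphism I'' I r) (h : q ⋙q p = r) (z : ClassifyingSpace I'') :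
    classifyingMap hp (classifyingMap hq z) = classifyingMap hr z := by
  induction z using ClassifyingSpace.ind with | h n c t =>
  simp [Cell.map_map hq hp hr h]

theorem classifyingMap_id (hp : IsCoveringMorphism I I (𝟭q Q)) (z : ClassifyingSpace I) :
    classifyingMap hp z = z := by
  induction z using ClassifyingSpace.ind with | h n c t =>
  simp [Cell.map_id hp]

/-- Before gluing, each simplex is mapped identically onto a simplex and every cell is hit, which
gives an open continuous surjection; the quotient property passes to the glued spaces. -/
theorem classifyingMap_isQuotientMap (hp : IsCoveringMorphism I' I p) :
    Topology.IsQuotientMap (classifyingMap hp) := by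
  have hcont : Continuous (Quot.mk (CellSum.Glue I')) := continuous_quot_mk
  let F : CellSum I' → CellSum I := fun z => ⟨⟨z.1.1, Cell.map hp z.1.2⟩, z.2⟩
  have hF : Continuous F := continuous_sigma fun c =>
    continuous_sigmaMk (σ := fun c : (Σ n : ℕ, Cell I n) => stdSimplex ℝ (Fin (c.1 + 1)))
      (i := ⟨c.1, Cell.map hp c.2⟩)
  have hFo : IsOpenMap F := isOpenMap_sigma.2 fun c =>
    isOpenMap_sigmaMk (σ := fun c : (Σ n : ℕ, Cell I n) => stdSimplex ℝ (Fin (c.1 + 1)))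
      (i := ⟨c.1, Cell.map hp c.2⟩)
  have hFs : Function.Surjective F := by
    rintro ⟨⟨n, c⟩, t⟩
    obtain ⟨c', rfl⟩ := Cell.map_surjective hp c
    exact ⟨⟨⟨n, c'⟩, t⟩, rfl⟩
  have h : Topology.IsQuotientMap (Quot.mk (CellSum.Glue I) ∘ F) :=
    isQuotientMap_quot_mk.comp (hFo.isQuotientMap hF hFs)
  exact Topology.IsQuotientMap.of_comp hcont (classifyingMap hp).continuous h

end ClassifyingMaps

/-! ### Open stars in the barycentric subdivision -/

section OpenStars

variable {k : Type w} [Field k] {Q : Type u} [Quiver.{v} Q] {I : PathIdeal k Q}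

/-- The chain obtained by keeping only the vertices in the image of `f`. -/
def PathChain.restrict {m n : ℕ} (c : PathChain Q n) (f : Fin (m + 1) ↪o Fin (n + 1)) :
    PathChain Q m where
  vertex i := c.vertex (f i)
  path i l h := c.path (f i) (f l) (f.monotone h)
  path_self _ := c.path_self _
  path_comp _ _ _ _ _ := c.path_comp _ _ _ _ _

theorem PathChain.IsCellChain.restrict {m n : ℕ} {c : PathChain Q n} (hc : c.IsCellChain I)
    (f : Fin (m + 1) ↪o Fin (n + 1)) : (c.restrict f).IsCellChain I where
  length_pos i l h := hc.length_pos _ _ (f.strictMono h)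
  total_notMem h := by
    apply hc.total_notMem
    have := I.ofPath_mid_mem (c.path 0 (f 0) (Fin.zero_le _)) _
      (c.path (f (Fin.last m)) (Fin.last n) (Fin.le_last _)) h
    simp only [PathChain.restrict] at this
    rwa [c.path_comp, c.path_comp] at this

/-- The iterated face of a cell spanned by the vertices in the image of `f`. -/
def Cell.restrict {m n : ℕ} (f : Fin (m + 1) ↪o Fin (n + 1)) : Cell I n → Cell I m :=
  Quot.map (fun c => ⟨c.1.restrict f, c.2.restrict f⟩) fun _ _ h _ _ _ => h _ _ _

theorem Cell.restrict_face {m n : ℕ} (f : Fin (m + 1) ↪o Fin (n + 1)) (j : Fin (n + 2))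
    (c : Cell I (n + 1)) :
    (c.face I j).restrict f = c.restrict (f.trans (Fin.succAboveOrderEmb j)) := by
  induction c using Quot.ind
  rfl

theorem Cell.restrict_map {Q' : Type u'} [Quiver.{v'} Q'] {I' : PathIdeal k Q'} {p : Q' ⥤q Q}
    (hp : IsCoveringMorphism I' I p) {m n : ℕ} (f : Fin (m + 1) ↪o Fin (n + 1)) (c : Cell I' n) :
    (Cell.map hp c).restrict f = Cell.map hp (c.restrict f) := by
  induction c using Quot.ind
  rfl

theorem stdSimplex.map_succAbove_apply {n : ℕ} (j : Fin (n + 2))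
    (t : stdSimplex ℝ (Fin (n + 1))) (i : Fin (n + 1)) :
    stdSimplex.map j.succAbove t (j.succAbove i) = t i := by
  rw [stdSimplex.map_coe, FunOnFinite.linearMap_apply_apply]
  simp [Finset.filter_eq']

theorem stdSimplex.map_succAbove_self {n : ℕ} (j : Fin (n + 2))
    (t : stdSimplex ℝ (Fin (n + 1))) : stdSimplex.map j.succAbove t j = 0 := by
  rw [stdSimplex.map_coe, FunOnFinite.linearMap_apply_apply]
  simp [Fin.succAbove_ne]

/-- A point of a simplex lies in the open star of the barycentre of the face with vertices in the
image of `f` if and only if its coordinates at these vertices are positive and larger than the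
other ones. -/
def stdSimplex.InStar {m n : ℕ} (f : Fin (m + 1) ↪o Fin (n + 1))
    (t : stdSimplex ℝ (Fin (n + 1))) : Prop :=
  ∀ i, 0 < t (f i) ∧ ∀ l, l ∉ Set.range f → t l < t (f i)

theorem stdSimplex.InStar.isOpen {m n : ℕ} (f : Fin (m + 1) ↪o Fin (n + 1)) :
    IsOpen {t : stdSimplex ℝ (Fin (n + 1)) | stdSimplex.InStar f t} := by
  have hc (i : Fin (n + 1)) : Continuous fun t : stdSimplex ℝ (Fin (n + 1)) => t i :=
    (continuous_apply i).comp continuous_subtype_val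
  simp only [stdSimplex.InStar, Set.ofPred_forall, Set.ofPred_and]
  exact isOpen_iInter_of_finite fun i => (isOpen_lt continuous_const (hc _)).inter <|
    isOpen_iInter_of_finite fun l => isOpen_iInter_of_finite fun _ => isOpen_lt (hc _) (hc _)

/-- The image of `f` must be the set of the `m + 1` largest coordinates. If two such sets of equal
size differed, each would have an element outside the other, and these two coordinates would each
exceed the other. -/
theorem stdSimplex.InStar.eq {m n : ℕ} {f f' : Fin (m + 1) ↪o Fin (n + 1)}
    {t : stdSimplex ℝ (Fin (n + 1))} (h : stdSimplex.InStar f t) (h' : stdSimplex.InStar f' t) : f = f' := by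
  classical
  have hcard (f : Fin (m + 1) ↪o Fin (n + 1)) : (Finset.univ.image f).card = m + 1 := by
    rw [Finset.card_image_of_injective _ f.injective, Finset.card_fin]
  have hsub : Finset.univ.image f ⊆ Finset.univ.image f' := by
    by_contra hn
    obtain ⟨a, ha, ha'⟩ := Finset.not_subset.1 hn
    obtain ⟨b, hb, hb'⟩ := Finset.not_subset.1 fun h₁ => hn
      (Finset.eq_of_subset_of_card_le h₁ (by rw [hcard, hcard])).ge
    simp only [Finset.mem_image, Finset.mem_univ, true_and] at ha ha' hb hb'
    obtain ⟨i, rfl⟩ := ha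
    obtain ⟨l, rfl⟩ := hb
    exact lt_asymm ((h i).2 _ hb') ((h' l).2 _ ha')
  have := Finset.eq_of_subset_of_card_le hsub (by rw [hcard, hcard])
  refine OrderEmbedding.range_inj.1 ?_
  simpa using congrArg (fun s : Finset _ => (s : Set (Fin (n + 1)))) this

/-- The only new coordinate is the one at `j`; it is 0, hence smaller than the positive coordinates
selected by `f`. -/
theorem stdSimplex.inStar_map_succAbove {m n : ℕ} (j : Fin (n + 2))
    (f : Fin (m + 1) ↪o Fin (n + 1)) (t : stdSimplex ℝ (Fin (n + 1))) :
    stdSimplex.InStar (f.trans (Fin.succAboveOrderEmb j)) (stdSimplex.map j.succAbove t) ↔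
      stdSimplex.InStar f t := by
  refine forall_congr' fun i => ?_
  simp only [RelEmbedding.coe_trans, Function.comp_apply, Fin.succAboveOrderEmb_apply,
    stdSimplex.map_succAbove_apply]
  refine and_congr_right fun h => ⟨fun H l hl => ?_, fun H l hl => ?_⟩
  · rw [← stdSimplex.map_succAbove_apply j]
    refine H _ ?_
    rintro ⟨a, ha⟩
    exact hl ⟨a, Fin.succAbove_right_injective ha⟩
  · obtain rfl | ⟨l, rfl⟩ := Fin.eq_self_or_eq_succAbove j l
    · rwa [stdSimplex.map_succAbove_self]
    · rw [stdSimplex.map_succAbove_apply]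
      exact H l fun ⟨a, ha⟩ => hl ⟨a, congrArg j.succAbove ha⟩

/-- Positivity of the selected coordinates keeps `j` out of the image of `f`. This is why positivity
is part of `stdSimplex.InStar`. -/
theorem stdSimplex.InStar.exists_factor {m n : ℕ} {j : Fin (n + 2)}
    {f : Fin (m + 1) ↪o Fin (n + 2)} {t : stdSimplex ℝ (Fin (n + 1))}
    (h : stdSimplex.InStar f (stdSimplex.map j.succAbove t)) :
    ∃ f' : Fin (m + 1) ↪o Fin (n + 1), f'.trans (Fin.succAboveOrderEmb j) = f := by
  have hne (i) : f i ≠ j := fun e => by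
    have := (h i).1
    rw [e, stdSimplex.map_succAbove_self] at this
    exact this.false
  choose a ha using fun i => Fin.exists_succAbove_eq (hne i)
  refine ⟨OrderEmbedding.ofStrictMono a fun i l hil => ?_, ?_⟩
  · rw [← (Fin.strictMono_succAbove j).lt_iff_lt, ha, ha]
    exact f.strictMono hil
  · ext i : 1
    exact ha i

/-- The set of positive coordinates works: it spans the face whose interior contains the point. -/
theorem stdSimplex.exists_inStar {n : ℕ} (t : stdSimplex ℝ (Fin (n + 1))) :
    ∃ (m : ℕ) (f : Fin (m + 1) ↪o Fin (n + 1)), stdSimplex.InStar f t := by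
  classical
  set s := Finset.univ.filter fun i => 0 < t i with hs
  have hne : s.Nonempty := by
    by_contra hn
    have h0 : ∀ i, t i = 0 := fun i => le_antisymm (not_lt.1 fun hi => hn ⟨i, by simp [hs, hi]⟩)
      (stdSimplex.zero_le t i)
    have := stdSimplex.sum_eq_one t
    simp [h0] at this
  obtain ⟨m, hm⟩ := Nat.exists_eq_succ_of_ne_zero hne.card_pos.ne'
  refine ⟨m, s.orderEmbOfFin hm, fun i => ?_⟩
  have hi : 0 < t (s.orderEmbOfFin hm i) := (Finset.mem_filter.1 (s.orderEmbOfFin_mem hm i)).2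
  refine ⟨hi, fun l hl => lt_of_le_of_lt ?_ hi⟩
  rw [Finset.range_orderEmbOfFin] at hl
  simpa [hs] using hl

/-- The open star of the barycentre of a cell in the barycentric subdivision of the classifying
space. -/
def Cell.openStar {m : ℕ} (c : Cell I m) : Set (ClassifyingSpace I) :=
  {z | Quot.lift (fun z : CellSum I => ∃ f : Fin (m + 1) ↪o Fin (z.1.1 + 1),
    z.1.2.restrict f = c ∧ stdSimplex.InStar f z.2) (by
      rintro _ _ ⟨n, d, j, t⟩
      refine propext ⟨?_, ?_⟩
      · rintro ⟨f, hf, ht⟩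
        exact ⟨f.trans (Fin.succAboveOrderEmb j), (d.restrict_face f j).symm.trans hf,
          (stdSimplex.inStar_map_succAbove j f t).2 ht⟩
      · rintro ⟨f, hf, ht⟩
        obtain ⟨f, rfl⟩ := ht.exists_factor
        exact ⟨f, (d.restrict_face f j).trans hf,
          (stdSimplex.inStar_map_succAbove j f t).1 ht⟩) z}

theorem Cell.mk_mem_openStar {m n : ℕ} {c : Cell I m} {d : Cell I n}
    {t : stdSimplex ℝ (Fin (n + 1))} :
    ClassifyingSpace.mk d t ∈ c.openStar ↔
      ∃ f : Fin (m + 1) ↪o Fin (n + 1), d.restrict f = c ∧ stdSimplex.InStar f t :=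
  Iff.rfl

/-- Several faces of one simplex may be the same cell `c`, so the trace of the star on a simplex is
a union over all such `f`. -/
theorem Cell.isOpen_openStar {m : ℕ} (c : Cell I m) : IsOpen c.openStar := by
  refine (isQuotientMap_quot_mk (r := CellSum.Glue I)).isOpen_preimage.1 ?_
  refine isOpen_sigma_iff.2 fun d => ?_
  have : (Sigma.mk d ⁻¹' (Quot.mk (CellSum.Glue I) ⁻¹' c.openStar)) =
      ⋃ (f : Fin (m + 1) ↪o Fin (d.1 + 1)) (_ : d.2.restrict f = c),
        {t : stdSimplex ℝ (Fin (d.1 + 1)) | stdSimplex.InStar f t} := by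
    ext t
    simp only [Set.mem_iUnion, exists_prop]
    exact Cell.mk_mem_openStar
  rw [this]
  exact isOpen_iUnion fun f => isOpen_iUnion fun _ => stdSimplex.InStar.isOpen f

/-- In a simplex containing the point, the coordinates determine `f`, and `f` determines the cell.
Equal dimension is essential: the star of a cell meets the stars of its faces. -/
theorem Cell.eq_of_mem_openStar {m : ℕ} {c c' : Cell I m} {z : ClassifyingSpace I}
    (h : z ∈ c.openStar) (h' : z ∈ c'.openStar) : c = c' := by
  induction z using ClassifyingSpace.ind with | h n d t =>
  obtain ⟨f, rfl, ht⟩ := Cell.mk_mem_openStar.1 h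
  obtain ⟨f', rfl, ht'⟩ := Cell.mk_mem_openStar.1 h'
  rw [ht.eq ht']

theorem ClassifyingSpace.exists_mem_openStar (z : ClassifyingSpace I) :
    ∃ (m : ℕ) (c : Cell I m), z ∈ c.openStar := by
  induction z using ClassifyingSpace.ind with | h n d t =>
  obtain ⟨m, f, hf⟩ := stdSimplex.exists_inStar t
  exact ⟨m, d.restrict f, Cell.mk_mem_openStar.2 ⟨f, rfl, hf⟩⟩

theorem classifyingMap_mem_openStar {Q' : Type u'} [Quiver.{v'} Q'] {I' : PathIdeal k Q'}
    {p : Q' ⥤q Q} (hp : IsCoveringMorphism I' I p) {m : ℕ} {c : Cell I' m}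
    {z : ClassifyingSpace I'} (h : z ∈ c.openStar) :
    classifyingMap hp z ∈ (Cell.map hp c).openStar := by
  induction z using ClassifyingSpace.ind with | h n d t =>
  obtain ⟨f, rfl, ht⟩ := Cell.mk_mem_openStar.1 h
  exact Cell.mk_mem_openStar.2 ⟨f, Cell.restrict_map hp f d, ht⟩

end OpenStars

/-! ### Connectedness of the classifying space -/

section Connectedness

variable {k : Type w} [Field k] {Q : Type u} [Quiver.{v} Q] {I : PathIdeal k Q}

/-- A path of length at most one does not lie in an admissible ideal. -/
theorem PathIdeal.IsAdmissible.ofPath_notMem (hI : I.IsAdmissible) {x y : Q}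
    {s : Quiver.Path x y} (hs : s.length < 2) : PathAlgebra.ofPath k (AnyPath.mk s) ∉ I := by
  intro h
  obtain ⟨_, -, -, h₂⟩ := hI
  have hmem : AnyPath.mk s ∈ (PathAlgebra.ofPath k (AnyPath.mk s)).support := by
    simp [PathAlgebra.ofPath]
  exact hs.not_ge ((Finsupp.mem_supported k _).1 (h₂ h) hmem)

theorem PathChain.ext_zero {c c' : PathChain Q 0} (h : c.vertex 0 = c'.vertex 0) : c = c' := by
  refine PathChain.ext_mk fun i j hij => ?_
  obtain rfl := Fin.fin_one_eq_zero i
  obtain rfl := Fin.fin_one_eq_zero j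
  rw [c.path_self, c'.path_self, h]

/-- The chain consisting of a single vertex. -/
def PathChain.ofVertex (x : Q) : PathChain Q 0 where
  vertex _ := x
  path _ _ _ := .nil
  path_self _ := rfl
  path_comp _ _ _ _ _ := rfl

theorem PathChain.isCellChain_ofVertex (hI : I.IsAdmissible) (x : Q) :
    (PathChain.ofVertex x).IsCellChain I where
  length_pos i j h := absurd h (by omega)
  total_notMem := hI.ofPath_notMem Nat.zero_lt_two

/-- The chain consisting of a single path. -/
def PathChain.ofPath {x y : Q} (s : Quiver.Path x y) : PathChain Q 1 where
  vertex
    | 0 => x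
    | 1 => y
  path
    | 0, 0, _ => .nil
    | 0, 1, _ => s
    | 1, 1, _ => .nil
    | 1, 0, h => absurd h (by decide)
  path_self
    | 0 => rfl
    | 1 => rfl
  path_comp
    | 0, 0, 0, _, _ => rfl
    | 0, 0, 1, _, _ => Quiver.Path.nil_comp _
    | 0, 1, 1, _, _ => rfl
    | 1, 1, 1, _, _ => rfl
    | 1, 0, _, h, _ => absurd h (by decide)
    | 0, 1, 0, _, h => absurd h (by decide)
    | 1, 1, 0, _, h => absurd h (by decide)

theorem PathChain.isCellChain_ofPath {x y : Q} {s : Quiver.Path x y} (hs : 0 < s.length)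
    (hsI : PathAlgebra.ofPath k (AnyPath.mk s) ∉ I) : (PathChain.ofPath s).IsCellChain I where
  length_pos
    | 0, 1, _ => hs
    | 0, 0, h => absurd h (by decide)
    | 1, 0, h => absurd h (by decide)
    | 1, 1, h => absurd h (by decide)
  total_notMem := hsI

/-- The point of the classifying space given by a vertex of the quiver. -/
noncomputable def ClassifyingSpace.ofVertex (hI : I.IsAdmissible) (x : Q) : ClassifyingSpace I :=
  .mk (Quot.mk _ ⟨PathChain.ofVertex x, PathChain.isCellChain_ofVertex hI x⟩)
    (stdSimplex.vertex 0)

theorem ClassifyingSpace.joined_mk {n : ℕ} (c : Cell I n) (t t' : stdSimplex ℝ (Fin (n + 1))) :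
    Joined (ClassifyingSpace.mk c t) (ClassifyingSpace.mk c t') :=
  (PathConnectedSpace.joined t t').map (ClassifyingSpace.continuous_mk c)

theorem ClassifyingSpace.exists_joined_ofVertex (hI : I.IsAdmissible) (z : ClassifyingSpace I) :
    ∃ x, Joined z (ClassifyingSpace.ofVertex hI x) := by
  induction z using ClassifyingSpace.ind with | h n c t =>
  induction n with
  | zero =>
    induction c using Quot.ind with | mk c =>
    refine ⟨c.1.vertex 0, ?_⟩
    have : c = ⟨PathChain.ofVertex (c.1.vertex 0), PathChain.isCellChain_ofVertex hI _⟩ :=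
      Subtype.ext (PathChain.ext_zero rfl)
    rw [ClassifyingSpace.ofVertex, ← this]
    exact ClassifyingSpace.joined_mk _ _ _
  | succ n ih =>
    -- Any point of a proper face will do, since the whole simplex is path connected.
    obtain ⟨x, hx⟩ := ih (c.face I 0) (stdSimplex.vertex 0)
    rw [ClassifyingSpace.mk_face] at hx
    exact ⟨x, (ClassifyingSpace.joined_mk _ _ _).trans hx⟩

/-- An arrow lies outside `I`, since `I ⊆ F ^ 2`, so it gives a 1-cell; face 1 of this cell is the
source and face 0 the target. -/
theorem ClassifyingSpace.joined_of_hom (hI : I.IsAdmissible) {x y : Q} (a : x ⟶ y) :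
    Joined (ClassifyingSpace.ofVertex hI x) (ClassifyingSpace.ofVertex hI y) := by
  let c : {c : PathChain Q 1 // c.IsCellChain I} :=
    ⟨PathChain.ofPath a.toPath, PathChain.isCellChain_ofPath Nat.zero_lt_one
      (hI.ofPath_notMem Nat.one_lt_two)⟩
  have hx : (⟨PathChain.ofVertex x, PathChain.isCellChain_ofVertex hI x⟩ :
      {c : PathChain Q 0 // c.IsCellChain I}) = ⟨c.1.face 1, c.2.face I 1⟩ :=
    Subtype.ext (PathChain.ext_zero rfl)
  have hy : (⟨PathChain.ofVertex y, PathChain.isCellChain_ofVertex hI y⟩ :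
      {c : PathChain Q 0 // c.IsCellChain I}) = ⟨c.1.face 0, c.2.face I 0⟩ :=
    Subtype.ext (PathChain.ext_zero rfl)
  let d : Cell I 1 := Quot.mk _ c
  have hx' : ClassifyingSpace.ofVertex hI x =
      .mk (d.face I 1) (stdSimplex.vertex 0) := by
    rw [ClassifyingSpace.ofVertex, hx]
    rfl
  have hy' : ClassifyingSpace.ofVertex hI y =
      .mk (d.face I 0) (stdSimplex.vertex 0) := by
    rw [ClassifyingSpace.ofVertex, hy]
    rfl
  rw [hx', hy', ClassifyingSpace.mk_face, ClassifyingSpace.mk_face]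
  exact ClassifyingSpace.joined_mk _ _ _

theorem ClassifyingSpace.pathConnectedSpace (hI : I.IsAdmissible) (hQ : IsConnectedQuiver Q) :
    PathConnectedSpace (ClassifyingSpace I) := by
  obtain ⟨⟨x₀⟩, hQ⟩ := hQ
  have hv (x y : Q) : Joined (ClassifyingSpace.ofVertex hI x) (ClassifyingSpace.ofVertex hI y) := by
    obtain ⟨s⟩ := hQ x y
    induction s with
    | nil => exact Joined.refl _
    | cons _ a ih =>
      refine ih.trans ?_
      obtain a | a := a
      · exact ClassifyingSpace.joined_of_hom hI a
      · exact (ClassifyingSpace.joined_of_hom hI a).symm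
  refine ⟨⟨ClassifyingSpace.ofVertex hI x₀⟩, fun z z' => ?_⟩
  obtain ⟨x, hx⟩ := ClassifyingSpace.exists_joined_ofVertex hI z
  obtain ⟨y, hy⟩ := ClassifyingSpace.exists_joined_ofVertex hI z'
  exact (hx.trans (hv x y)).trans hy.symm

end Connectedness

/-! ### Quotient covering maps -/

section QuotientCoverings

variable {E X G : Type*} [TopologicalSpace E] [TopologicalSpace X] [Group G] [MulAction G E]
  {f : C(E, X)}

/-- Normality holds because the image of π₁ is the kernel of the monodromy homomorphism. -/
theorem IsQuotientCoveringMap.isRegularCovering [PathConnectedSpace E]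
    (hf : IsQuotientCoveringMap f G) : IsRegularCovering f where
  pathConnected := inferInstance
  isCoveringMap := hf.isCoveringMap
  surjective := hf.surjective
  normal_range x := by
    have h : FundamentalGroup.mapOfEq f (rfl : f x = f x) = FundamentalGroup.map f x := by
      ext γ
      rw [FundamentalGroup.mapOfEq_apply, Path.Homotopic.Quotient.cast_rfl_rfl]
      rfl
    have hker : _ = (FundamentalGroup.mapOfEq f (rfl : f x = f x)).range :=
      hf.ker_monodromyPerm (x := f x) ⟨x, rfl⟩
    rw [← h, ← hker]
    infer_instance

/-- The group of a quotient covering map of a connected space is its group of covering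
automorphisms. -/
theorem IsQuotientCoveringMap.nonempty_coveringAutomorphisms_mulEquiv [ConnectedSpace E]
    (hf : IsQuotientCoveringMap f G) : Nonempty (coveringAutomorphisms f ≃* G) := by
  have := hf.toContinuousConstSMul
  have := hf.isCancelSMul
  let F : G →* coveringAutomorphisms f :=
    { toFun g := ⟨Homeomorph.smul g, fun _ => hf.map_smul g⟩
      map_one' := by
        ext x
        exact one_smul G x
      map_mul' g h := by
        ext x
        exact mul_smul g h x }
  obtain ⟨x⟩ : Nonempty E := inferInstance
  refine ⟨(MulEquiv.ofBijective F ⟨fun g h e => ?_, fun φ => ?_⟩).symm⟩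
  · exact IsCancelSMul.right_cancel g h x (DFunLike.congr_fun (congrArg Subtype.val e) x)
  -- Choose `g` with `g • x = φ x`; then `φ` and the action of `g` are lifts of `f` agreeing at one
  -- point of a connected space.
  · obtain ⟨g, hg⟩ := hf.apply_eq_iff_mem_orbit.1 (φ.2 x)
    refine ⟨g, Subtype.ext (DFunLike.coe_injective ?_)⟩
    exact hf.isCoveringMap.eq_of_comp_eq (Homeomorph.smul g).continuous φ.1.continuous
      (funext fun y => (hf.map_smul g).trans (φ.2 y).symm) x hg

end QuotientCoverings

/-! ### Galois coverings of bound quivers -/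

section GaloisCoverings

variable {k : Type w} [Field k] {Q' : Type u'} [Quiver.{v'} Q'] {Q : Type u} [Quiver.{v} Q]
  {I' : PathIdeal k Q'} {I : PathIdeal k Q} {p : Q' ⥤q Q} {G : Type*} [Group G]
  {act : G →* BoundQuiverAut I'}

namespace IsGaloisCovering

variable (hp : IsGaloisCovering I' I p act)
include hp

/-- The action of `g⁻¹` provides preimages of vertices and lifts of relations; bijectivity on arrows
follows by cancelling `p` in `p g = p`. Hence the induced maps on cells and spaces are available for
`g`. -/
theorem isCoveringMorphism_act (g : G) : IsCoveringMorphism I' I' (act g).toPrefunctor := by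
  have hinv : (act g⁻¹).toPrefunctor ⋙q (act g).toPrefunctor = 𝟭q Q' := by
    have : act g * act g⁻¹ = 1 := by rw [← map_mul, mul_inv_cancel, map_one]
    exact congrArg BoundQuiverAut.toPrefunctor this
  have hobj (x : Q') : (act g).toPrefunctor.obj ((act g⁻¹).toPrefunctor.obj x) = x :=
    congrArg (fun F : Q' ⥤q Q' => F.obj x) hinv
  have hinv' : (act g).toPrefunctor ⋙q (act g⁻¹).toPrefunctor = 𝟭q Q' := by
    have : act g⁻¹ * act g = 1 := by rw [← map_mul, inv_mul_cancel, map_one]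
    exact congrArg BoundQuiverAut.toPrefunctor this
  have hobj' (x : Q') : (act g⁻¹).toPrefunctor.obj ((act g).toPrefunctor.obj x) = x :=
    congrArg (fun F : Q' ⥤q Q' => F.obj x) hinv'
  refine ⟨(act g).val.isMorphism, fun x => ⟨_, hobj x⟩, ?_, fun x y ρ hρ hρ' x' hx' => ?_⟩
  · refine Prefunctor.IsCovering.of_comp_right _ p hp.isCovering ?_
    rw [hp.comp_eq]
    exact hp.isCovering
  · subst hx'
    refine ⟨(act g⁻¹).toPrefunctor.obj y, hobj y, PathAlgebra.map k (act g⁻¹).toPrefunctor ρ,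
      (act g⁻¹).val.isMorphism _ hρ, ?_, ?_⟩
    · have := PathAlgebra.map_mem_homSpace (p := (act g⁻¹).toPrefunctor) hρ'
      rwa [hobj'] at this
    · have e : AnyPath.map (act g).toPrefunctor ∘ AnyPath.map (act g⁻¹).toPrefunctor = id :=
        funext fun s => by rw [Function.comp_apply, ← AnyPath.map_comp, hinv, AnyPath.map_id, id]
      rw [PathAlgebra.map, PathAlgebra.map, Finsupp.lmapDomain_apply, Finsupp.lmapDomain_apply,
        ← Finsupp.mapDomain_comp, e, Finsupp.mapDomain_id]

theorem exists_map_act_eq {n : ℕ} {c c' : Cell I' n}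
    (h : Cell.map hp.toIsCoveringMorphism c = Cell.map hp.toIsCoveringMorphism c') :
    ∃ g, Cell.map (hp.isCoveringMorphism_act g) c = c' := by
  obtain ⟨g, hg⟩ := hp.vertex_orbit c.source c'.source <| by
    rw [← Cell.source_map hp.toIsCoveringMorphism, h, Cell.source_map]
  refine ⟨g, Cell.eq_of_map_eq hp.toIsCoveringMorphism ?_ ?_⟩
  · rw [Cell.source_map, hg]
  · rw [Cell.map_map _ _ hp.toIsCoveringMorphism (hp.comp_eq g), h]

theorem eq_one_of_map_act_eq {n : ℕ} {c : Cell I' n} {g : G}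
    (h : Cell.map (hp.isCoveringMorphism_act g) c = c) : g = 1 := by
  refine hp.free g c.source ?_
  rw [← Cell.source_map (hp.isCoveringMorphism_act g), h]

/-- The action on the classifying space of the group of a Galois covering. -/
@[reducible]
def classifyingSpaceAction : MulAction G (ClassifyingSpace I') where
  smul g := classifyingMap (hp.isCoveringMorphism_act g)
  one_smul z := by
    have h : (act 1).toPrefunctor = 𝟭q Q' := by
      rw [map_one]
      rfl
    -- The morphism is generalised because the proof that it is a covering morphism depends on it,
    -- which blocks direct rewriting.
    have h' (F : Q' ⥤q Q') (hF : IsCoveringMorphism I' I' F) (e : F = 𝟭q Q') :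
        classifyingMap hF z = z := by
      subst e
      exact classifyingMap_id hF z
    exact h' _ _ h
  mul_smul g h z := by
    refine (classifyingMap_map _ _ _ ?_ z).symm
    rw [map_mul]
    rfl

theorem classifyingMap_act (g : G) (z : ClassifyingSpace I') :
    classifyingMap hp.toIsCoveringMorphism (classifyingMap (hp.isCoveringMorphism_act g) z) =
      classifyingMap hp.toIsCoveringMorphism z :=
  classifyingMap_map _ _ _ (hp.comp_eq g) z

/-- Points with the same image are in the same orbit: the gluing relation lifts. -/
theorem exists_lift_glue {a b : CellSum I}
    (h : Relation.EqvGen (CellSum.Glue I) a b) :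
    (∀ c' : Cell I' a.1.1, Cell.map hp.toIsCoveringMorphism c' = a.1.2 →
      ∃ d' : Cell I' b.1.1, Cell.map hp.toIsCoveringMorphism d' = b.1.2 ∧
        ClassifyingSpace.mk c' a.2 = ClassifyingSpace.mk d' b.2) ∧
    ∀ d' : Cell I' b.1.1, Cell.map hp.toIsCoveringMorphism d' = b.1.2 →
      ∃ c' : Cell I' a.1.1, Cell.map hp.toIsCoveringMorphism c' = a.1.2 ∧
        ClassifyingSpace.mk d' b.2 = ClassifyingSpace.mk c' a.2 := by
  induction h with
  | rel _ _ h =>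
    obtain ⟨n, c, j, t⟩ := h
    constructor
    · intro c' hc'
      obtain ⟨d', rfl⟩ := Cell.map_surjective hp.toIsCoveringMorphism c
      -- An arbitrary lift `d'` of the larger cell may have the wrong face; that face lies over the
      -- same cell as `c'`, so some `g` moves it to `c'`, and `g` is applied to `d'`.
      obtain ⟨g, rfl⟩ := hp.exists_map_act_eq (c := d'.face I' j) (c' := c') <| by
        rw [hc', Cell.map_face]
      refine ⟨Cell.map (hp.isCoveringMorphism_act g) d', ?_, ?_⟩
      · exact Cell.map_map _ _ hp.toIsCoveringMorphism (hp.comp_eq g) d'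
      · rw [Cell.map_face]
        exact ClassifyingSpace.mk_face _ j t
    · intro (d' : Cell I' (n + 1)) (hd : Cell.map _ d' = c)
      subst hd
      exact ⟨d'.face I' j, Cell.map_face _ j d', (ClassifyingSpace.mk_face d' j t).symm⟩
  | refl _ => exact ⟨fun c' hc' => ⟨c', hc', rfl⟩, fun c' hc' => ⟨c', hc', rfl⟩⟩
  | symm _ _ _ ih => exact ih.symm
  | trans _ _ _ _ _ ih₁ ih₂ =>
    constructor
    · intro c' hc'
      obtain ⟨d', hd', e₁⟩ := ih₁.1 c' hc'
      obtain ⟨f', hf', e₂⟩ := ih₂.1 d' hd'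
      exact ⟨f', hf', e₁.trans e₂⟩
    · intro c' hc'
      obtain ⟨d', hd', e₁⟩ := ih₂.2 c' hc'
      obtain ⟨f', hf', e₂⟩ := ih₁.2 d' hd'
      exact ⟨f', hf', e₁.trans e₂⟩

/-- Lift the chain of gluings joining the two images, starting at `z`. It ends in a simplex over the
same cell as that of `z'`, with the same barycentric coordinates, and transitivity on lifts of a
cell finishes. -/
theorem exists_act_eq {z z' : ClassifyingSpace I'}
    (h : classifyingMap hp.toIsCoveringMorphism z = classifyingMap hp.toIsCoveringMorphism z') :
    ∃ g, classifyingMap (hp.isCoveringMorphism_act g) z' = z := by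
  induction z using ClassifyingSpace.ind with | h n c t =>
  induction z' using ClassifyingSpace.ind with | h n' c' t' =>
  obtain ⟨d, hd, e⟩ := (hp.exists_lift_glue (Quot.eqvGen_exact h)).1 c rfl
  obtain ⟨g, rfl⟩ := hp.exists_map_act_eq (c := c') (c' := d) hd.symm
  exact ⟨g, e.symm⟩

theorem isQuotientCoveringMap :
    letI := hp.classifyingSpaceAction
    IsQuotientCoveringMap (classifyingMap hp.toIsCoveringMorphism) G := by
  let := hp.classifyingSpaceAction
  refine @IsQuotientCoveringMap.mk _ _ _ _ _ _ _ _ (classifyingMap_isQuotientMap _)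
    ⟨fun g => (classifyingMap (hp.isCoveringMorphism_act g)).continuous⟩ ?_ ?_
  · intro z z'
    refine ⟨hp.exists_act_eq, ?_⟩
    rintro ⟨g, rfl⟩
    exact hp.classifyingMap_act g z'
  · intro z
    obtain ⟨m, c, hz⟩ := z.exists_mem_openStar
    refine ⟨c.openStar, c.isOpen_openStar.mem_nhds hz, ?_⟩
    -- The point `g • y` lies in the stars of `c` and of its translate by `g`, which have the same
    -- dimension and so coincide.
    rintro g ⟨_, ⟨y, hy, rfl⟩, hy'⟩
    exact hp.eq_one_of_map_act_eq
      (Cell.eq_of_mem_openStar (classifyingMap_mem_openStar _ hy) hy')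

end IsGaloisCovering

end GaloisCoverings

theorem theorem4p5 {k : Type w} [Field k]
    {Q' : Type u'} [Quiver.{v' + 1} Q'] {Q : Type u} [Quiver.{v + 1} Q]
    [Finite Q] [∀ x y : Q, Finite (x ⟶ y)]
    (I' : PathIdeal k Q') (I : PathIdeal k Q)
    (hI' : I'.IsAdmissible) (hI : I.IsAdmissible)
    (hQ' : IsConnectedQuiver Q')
    {G : Type*} [Group G] (act : G →* BoundQuiverAut I')
    (p : Q' ⥤q Q) (hp : IsGaloisCovering I' I p act) :
    IsRegularCovering (classifyingMap hp.toIsCoveringMorphism) ∧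
      Nonempty (coveringAutomorphisms (classifyingMap hp.toIsCoveringMorphism) ≃* G) := by
  have := ClassifyingSpace.pathConnectedSpace hI' hQ'
  let := hp.classifyingSpaceAction
  exact ⟨hp.isQuotientCoveringMap.isRegularCovering,
    hp.isQuotientCoveringMap.nonempty_coveringAutomorphisms_mulEquiv⟩
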